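/- **Theorem (Counting FloodSet with perfect recall).** Consider $n$ agents with initial values in $\{0,1\}$ and the hard crash failure model $\mathit{Crash}_t$ with $t<n$: at most $t$ agents crash; an agent that crashes in a round delivers an arbitrary subset of its messages of that round, has the local state $\mathit{crashed}$ from the end of that round on, and sends nothing afterwards; all other messages are delivered. In *Counting FloodSet with perfect recall*, the local state of a nonfailed agent is $\langle W,h,m,v\rangle$, where $W$ is the set of values seen so far, $h$ is the list in which $h[k]$, for $1\le k\le m$, is the number of agents from which no message was received in round $k$, $m$ is the time, and $v$ is the agent's initial value; the initial state is $\langle\{v\},[0],0,v\rangle$. In every round each nonfailed agent sends $W$ to all agents (a nonfailed agent always receives its own message), adds all values received to $W$, and appends the number of missing messages to $h$. *Counting FloodSet* is the same, except that only the number of messages missing in the latest round is kept (initially $0$). Decisions affect neither messages nor states. A point is a pair of a run and a time; an agent knows $\varphi$ at a point if $\varphi$ holds at all points of the system at which it has the same local state; $\mathcal N$ is the set of nonfailed agents at a point; and $C_{\mathcal N}\varphi$ means $E_{\mathcal N}^k\varphi$ for all $k\ge 1$, where $E_{\mathcal N}\varphi$ says that every agent in $\mathcal N$ knows $\varphi$.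 Let $\exists v$ say that some agent has initial value $v$. Let $r$ be a run of Counting FloodSet with perfect recall, $\mathcal I$ the system of all its runs, and $m\ge 0$ a time. 1. For every agent $i$ whose local state at $(r,m)$ is $\langle W,h,m,v_i\rangle$ (i.e. that has not crashed), $$(\mathcal I,r,m)\models \bigvee_{v\in\{0,1\}} C_{\mathcal N}(\exists v)\quad\Longleftrightarrow\quad m\ge\min\{t+1,n-1\}\ \text{ or }\ h[k]\ge n-1\text{ for some }1\le k\le m .$$ 2. Perfect recall gives no earlier stopping: if $r'$ is the run of Counting FloodSet with the same initial values and the same failures as $r$, and $\mathcal I'$ is the system of all runs of Counting FloodSet, then $(\mathcal I,r,m)\models\bigvee_{v} C_{\mathcal N}(\exists v)$ if and only if $(\mathcal I',r',m)\models\bigvee_{v} C_{\mathcal N}(\exists v)$. -/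

import Mathlib

namespace FloodSBA

/-- The possible initial values `0` and `1`. -/
abbrev Value : Type := Fin 2

/-- The actions of an agent in simultaneous Byzantine agreement. -/
inductive Action : Type
  | decide (v : Value)
  | noop

/-- Adversaries of the hard crash failure model `Crash_t` for `n` agents.
`delivers k i j = true` says that the adversary lets the message of `i` to `j` through in
round `k + 1`, i.e. between time `k` and time `k + 1`; `delivers k i i = false` says that `i`
has crashed by the end of that round. -/
@[ext]
structure Adversary (n t : ℕ) where
  delivers : ℕ → Fin n → Fin n → Bool
  /-- Messages are lost only through a crash of their sender in the same round or earlier. -/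
  crash_of_lost : ∀ k i j, delivers k i j = false → delivers k i i = false
  /-- A crashed agent sends no message in later rounds. -/
  silent_of_crash : ∀ k i, delivers k i i = false → ∀ k', k < k' → ∀ j, delivers k' i j = false
  /-- At most `t` agents are faulty. -/
  faulty_le : {i : Fin n | ∃ k j, delivers k i j = false}.ncard ≤ t

/-- An information exchange protocol for `n` agents in the failure model `Crash_t`; all agents use
the same type `L` of local states and the same type `M` of messages, and `none` stands for
"no message". `start i v` is the unique initial local state of agent `i` with initial value `v`. -/
structure InfoExchange (n t : ℕ) where
  L : Type
  M : Type
  crashed : L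
  start : Fin n → Value → L
  send : Fin n → L → Action → Fin n → Option M
  update : Fin n → L → Adversary n t → Action → (Fin n → Option M) → L

variable {n t : ℕ}

/-- A global state: an environment state (the adversary) and a local state of each agent. -/
abbrev GlobalState (E : InfoExchange n t) : Type := Adversary n t × (Fin n → E.L)

/-- A run assigns a global state to each time. -/
abbrev Run (E : InfoExchange n t) : Type := ℕ → GlobalState E

/-- A decision protocol. -/
abbrev DecisionProtocol (E : InfoExchange n t) : Type := Fin n → E.L → Action

/-- The messages that agent `i` receives in the round that starts in global state `g` at time
`k`, indexed by sender. -/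
def received (E : InfoExchange n t) (P : DecisionProtocol E) (k : ℕ) (g : GlobalState E)
    (i : Fin n) : Fin n → Option E.M :=
  fun j => if g.1.delivers k j i = true then E.send j (g.2 j) (P j (g.2 j)) i else none

/-- The system of all runs of the information exchange `E` with the decision protocol `P`. -/
def system (E : InfoExchange n t) (P : DecisionProtocol E) : Set (Run E) :=
  {r | (∃ v : Fin n → Value, ∀ i, (r 0).2 i = E.start i (v i)) ∧
    ∀ k, (r (k + 1)).1 = (r k).1 ∧
      ∀ i, (r (k + 1)).2 i =
        E.update i ((r k).2 i) (r k).1 (P i ((r k).2 i)) (received E P k (r k) i)}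

/-! ### Logic of knowledge

A formula is represented by its truth value at each point `(r, m)`. -/

/-- (Truth values of) formulas. -/
abbrev Formula (E : InfoExchange n t) : Type := Run E → ℕ → Prop

/-- The set of agents that have not failed at the point `(r, m)`. -/
def nonfailed {E : InfoExchange n t} (r : Run E) (m : ℕ) : Set (Fin n) :=
  {i | (r m).2 i ≠ E.crashed}

/-- The atomic proposition "some agent has initial value `v` in the current run". -/
def someInit {E : InfoExchange n t} (v : Value) : Formula E :=
  fun r _ => ∃ i, (r 0).2 i = E.start i v

/-- Agent `i` knows `φ`, in the system `R`. -/
def Knows {E : InfoExchange n t} (R : Set (Run E)) (i : Fin n) (φ : Formula E) : Formula E :=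
  fun r m => ∀ r' ∈ R, ∀ m', (r m).2 i = (r' m').2 i → φ r' m'

/-- Every nonfailed agent knows `φ`. -/
def EveryoneKnows {E : InfoExchange n t} (R : Set (Run E)) (φ : Formula E) : Formula E :=
  fun r m => ∀ i ∈ nonfailed r m, Knows R i φ r m

/-- `φ` is common knowledge among the nonfailed agents: "everyone knows", iterated `k` times,
holds of `φ` for every `k ≥ 1`. -/
def CommonKnowledge {E : InfoExchange n t} (R : Set (Run E)) (φ : Formula E) : Formula E :=
  fun r m => ∀ k : ℕ, 1 ≤ k → ((EveryoneKnows R)^[k] φ) r m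

/-- For some value `v`, it is common knowledge that `v` is the initial value of some agent. -/
def CommonKnowledgeOfSomeValue {E : InfoExchange n t} (R : Set (Run E)) : Formula E :=
  fun r m => ∃ v : Value, CommonKnowledge R (someInit v) r m

/-- Two runs correspond if they have the same failure pattern and the same initial values. -/
def Corresponding {E E' : InfoExchange n t} (r : Run E) (r' : Run E') : Prop :=
  (r 0).1 = (r' 0).1 ∧ ∀ i v, (r 0).2 i = E.start i v ↔ (r' 0).2 i = E'.start i v

/-! ### The counting variants of FloodSet -/

/-- Local states `⟨W, h, τ, v⟩`: the set `W` of values seen so far, the record `h` of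
missing-message counts, the time `τ`, and the initial value `v`; or `crashed`. -/
inductive LocalState (H : Type) : Type
  | crashed
  | active (W : Set Value) (h : H) (τ : ℕ) (v : Value)

/-- Each nonfailed agent sends its set `W` to every agent. -/
def floodSend {H : Type} : LocalState H → Option (Set Value)
  | .crashed => none
  | .active W _ _ _ => some W

/-- The number of agents from which no message was received. (The message of a nonfailed agent to
itself is always received, so that only messages of other agents can be missing for it.) -/
noncomputable def missing (msgs : Fin n → Option (Set Value)) : ℕ :=
  {j | msgs j = none}.ncard

open Classical in
/-- State update of agent `i`: unless the agent crashes, it adds the values received to `W`, and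
updates its record `h` by `record h c`, where `c` is the number of missing messages. -/
noncomputable def floodUpdate {H : Type} (record : H → ℕ → H) (i : Fin n) (s : LocalState H)
    (F : Adversary n t) (msgs : Fin n → Option (Set Value)) : LocalState H :=
  match s with
  | .crashed => .crashed
  | .active W h τ v =>
      if F.delivers τ i i = true then
        .active (W ∪ {x | ∃ j W', msgs j = some W' ∧ x ∈ W'}) (record h (missing msgs)) (τ + 1) v
      else .crashed

/-- Counting FloodSet: only the number of messages missing in the last round is stored. -/
noncomputable def countExchange (n t : ℕ) : InfoExchange n t where
  L := LocalState ℕ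
  M := Set Value
  crashed := .crashed
  start _ v := .active {v} 0 0 v
  send _ s _ _ := floodSend s
  update i s F _ msgs := floodUpdate (fun _ c => c) i s F msgs

/-- Counting FloodSet with perfect recall: the number of messages missing in the current round is
appended to the list `h`, which is `[0]` initially, so that the entry of `h` with index `k ≥ 1`
is the number of messages missing in round `k`. -/
noncomputable def countRecallExchange (n t : ℕ) : InfoExchange n t where
  L := LocalState (List ℕ)
  M := Set Value
  crashed := .crashed
  start _ v := .active {v} [0] 0 v
  send _ s _ _ := floodSend s
  update i s F _ msgs := floodUpdate (fun h c => h ++ [c]) i s F msgs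

end FloodSBA

/-!
If all survivors must have seen the same values by time `m`, or if an agent has missed the messages
of all others and so is known to be the only survivor, then the initial value of a survivor is
common knowledge. Otherwise there is a chain of points, each of which some survivor cannot tell from
the next, to a point at which all initial values are equal to any prescribed value. It rests on two
facts. If two survivors have initial values that exhaust all initial values of the run, then both
have seen everything, so failures can be undone one delivery at a time, each time unnoticed by one
of the two. And if `m ≤ t` and `m + 2 ≤ n`, then in `m` rounds the value of an agent can be passed
along a chain of crashing agents, so that at time `m` it is known to one survivor but not to
another; this allows changing that value.

The chain keeps the counts of missing messages in all rounds, not only in the last one, unchanged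
for the survivor in question, so perfect recall of them does not help.
-/

namespace FloodSBA

variable {n t : ℕ}

theorem range_update_const {ι α : Type*} [DecidableEq ι] {i j : ι} (hij : i ≠ j) (v w : α) :
    Set.range (Function.update (fun _ => v) i w) = {v, w} := by
  ext x
  constructor
  · rintro ⟨a, rfl⟩
    by_cases ha : a = i <;> simp [ha]
  · rintro (rfl | rfl)
    exacts [⟨j, by simp [hij.symm]⟩, ⟨i, by simp⟩]

theorem exists_eq_pair_of_mem {s : Set Value} {v : Value} (hv : v ∈ s) : ∃ w, s = {v, w} := by
  rcases s.subsingleton_or_nontrivial with hs | hs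
  · exact ⟨v, by rw [Set.pair_eq_singleton, hs.eq_singleton_of_mem hv]⟩
  · obtain ⟨w, hw, hne⟩ := hs.exists_ne v
    have hcover : ∀ v w x : Value, w ≠ v → x = v ∨ x = w := by decide
    exact ⟨w, subset_antisymm (fun x _ => hcover v w x hne) (Set.pair_subset hv hw)⟩

namespace Adversary

variable {F F' : Adversary n t} {k m : ℕ} {i j : Fin n}

/-- Agent `i` has not crashed by time `m`. -/
def Alive (F : Adversary n t) (m : ℕ) (i : Fin n) : Prop :=
  ∀ k < m, F.delivers k i i = true

theorem alive_zero : F.Alive 0 i := fun _ h => absurd h (Nat.not_lt_zero _)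

theorem alive_succ : F.Alive (m + 1) i ↔ F.Alive m i ∧ F.delivers m i i = true :=
  Nat.forall_lt_succ_right

theorem Alive.delivers (h : F.Alive m i) (hk : k < m) (j : Fin n) : F.delivers k i j = true := by
  by_contra hlost
  have hcrash := F.crash_of_lost k i j (Bool.not_eq_true _ ▸ hlost)
  exact Bool.false_ne_true (hcrash.symm.trans (h k hk))

theorem alive_of_delivers (h : F.delivers k j i = true) : F.Alive k j := by
  intro l hl
  by_contra hcrash
  have hlost := F.silent_of_crash l j (Bool.not_eq_true _ ▸ hcrash) k hl i
  exact Bool.false_ne_true (hlost.symm.trans h)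

/-! ### Flow of information -/

/-- The agents whose initial value has reached agent `i` by time `m`. The set `W` of values seen by
`i` is the image of this set under the initial values, as long as `i` has not crashed. -/
def heardFrom (F : Adversary n t) : ℕ → Fin n → Set (Fin n)
  | 0, i => {i}
  | m + 1, i => F.heardFrom m i ∪ {x | ∃ j, F.delivers m j i = true ∧ x ∈ F.heardFrom m j}

theorem heardFrom_mono (F : Adversary n t) (i : Fin n) : Monotone (F.heardFrom · i) :=
  monotone_nat_of_le_succ fun _ => Set.subset_union_left

theorem self_mem_heardFrom (F : Adversary n t) (m : ℕ) (i : Fin n) : i ∈ F.heardFrom m i :=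
  F.heardFrom_mono i m.zero_le rfl

theorem Alive.mem_heardFrom (hj : F.Alive m j) (hm : 0 < m) (i : Fin n) : j ∈ F.heardFrom m i :=
  F.heardFrom_mono i hm (Or.inr ⟨j, hj.delivers hm i, rfl⟩)

theorem heardFrom_congr (h : ∀ k < m, ∀ a b, F.delivers k a b = F'.delivers k a b) (i : Fin n) :
    F.heardFrom m i = F'.heardFrom m i := by
  induction m generalizing i with
  | zero => rfl
  | succ m ih =>
    simp only [heardFrom, ih fun k hk => h k (hk.trans m.lt_succ_self), h m m.lt_succ_self]

theorem heardFrom_succ_congr (h : ∀ k < m, ∀ a b, F.delivers k a b = F'.delivers k a b)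
    (hi : ∀ a, F.delivers m a i = F'.delivers m a i) :
    F.heardFrom (m + 1) i = F'.heardFrom (m + 1) i := by
  simp only [heardFrom, heardFrom_congr h, hi]

theorem image_heardFrom_eq_range {α : Type*} {V : Fin n → α} (hj : j ∈ F.heardFrom m i)
    (hV : Set.range V = {V i, V j}) : V '' F.heardFrom m i = Set.range V := by
  refine (Set.image_subset_range _ _).antisymm ?_
  rw [hV, ← Set.image_pair]
  exact Set.image_mono (Set.pair_subset (F.self_mem_heardFrom m i) hj)

/-! ### Agreement -/

/-- At time `m`, all agents that have not crashed have heard from the same agents. -/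
def Agree (F : Adversary n t) (m : ℕ) : Prop :=
  ∀ i j, F.Alive m i → F.Alive m j → F.heardFrom m i ⊆ F.heardFrom m j

/-- No agent crashes in round `k + 1`. -/
def CleanRound (F : Adversary n t) (k : ℕ) : Prop :=
  ∀ a, F.Alive k a → F.Alive (k + 1) a

theorem Agree.mono (h : F.Agree k) (hkm : k ≤ m) : F.Agree m := by
  induction m, hkm using Nat.le_induction with
  | base => exact h
  | succ m _ ih =>
    rintro i j hi hj x (hx | ⟨a, ha, hx⟩)
    · exact Or.inl (ih i j (alive_succ.1 hi).1 (alive_succ.1 hj).1 hx)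
    · exact Or.inl (ih a j (alive_of_delivers ha) (alive_succ.1 hj).1 hx)

theorem CleanRound.agree (h : F.CleanRound k) : F.Agree (k + 1) := by
  intro i j hi _ x hx
  have forwarded : ∀ a, F.Alive k a → x ∈ F.heardFrom k a → x ∈ F.heardFrom (k + 1) j :=
    fun a ha hxa => Or.inr ⟨a, (h a ha).delivers k.lt_succ_self j, hxa⟩
  rcases hx with hx | ⟨a, ha, hx⟩
  · exact forwarded i (alive_succ.1 hi).1 hx
  · exact forwarded a (alive_of_delivers ha) hx

theorem le_ncard_crashed (h : ∀ k < m, ¬ F.CleanRound k) : m ≤ {a | ¬ F.Alive m a}.ncard := by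
  induction m with
  | zero => exact Nat.zero_le _
  | succ m ih =>
    obtain ⟨a, ha, ha'⟩ : ∃ a, F.Alive m a ∧ ¬ F.Alive (m + 1) a := by
      simpa only [CleanRound, not_forall, exists_prop] using h m m.lt_succ_self
    have hssub : {a | ¬ F.Alive m a} ⊂ {a | ¬ F.Alive (m + 1) a} :=
      Set.ssubset_iff_exists.2 ⟨fun b hb hb' => hb (alive_succ.1 hb').1, a, ha', fun hb => hb ha⟩
    exact (ih fun k hk => h k (hk.trans m.lt_succ_self)).trans_lt (Set.ncard_lt_ncard hssub)

theorem ncard_crashed_le (F : Adversary n t) (m : ℕ) : {a | ¬ F.Alive m a}.ncard ≤ t := by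
  refine (Set.ncard_le_ncard fun a ha => ?_).trans F.faulty_le
  simp only [Alive, Set.mem_ofPred_eq, not_forall, Bool.not_eq_true] at ha
  obtain ⟨k, -, hk⟩ := ha
  exact ⟨k, a, hk⟩

theorem ncard_crashed_add_two_le (hij : i ≠ j) (hi : F.Alive m i) (hj : F.Alive m j) :
    {a | ¬ F.Alive m a}.ncard + 2 ≤ n := by
  have hsub : ({i, j} : Set (Fin n)) ⊆ {a | ¬ F.Alive m a}ᶜ :=
    Set.pair_subset (not_not_intro hi) (not_not_intro hj)
  have htwo := Set.ncard_le_ncard hsub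
  have hadd := Set.ncard_add_ncard_compl {a | ¬ F.Alive m a}
  rw [Set.ncard_pair hij] at htwo
  rw [Nat.card_fin] at hadd
  omega

theorem agree_of_le (hm : min (t + 1) (n - 1) ≤ m) : F.Agree m := by
  by_cases hclean : ∃ k < m, F.CleanRound k
  · obtain ⟨k, hk, h⟩ := hclean
    exact h.agree.mono hk
  · intro i j hi hj
    suffices i = j by rw [this]
    by_contra hij
    have hle := le_ncard_crashed fun k hk h => hclean ⟨k, hk, h⟩
    have hfaulty := F.ncard_crashed_le m
    have hsurvivors := ncard_crashed_add_two_le hij hi hj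
    omega

/-! ### Missing messages -/

/-- The number of messages to `i` that are missing in round `k + 1`. -/
noncomputable def lost (F : Adversary n t) (k : ℕ) (i : Fin n) : ℕ :=
  {j | F.delivers k j i = false}.ncard

theorem lost_congr (h : ∀ a, F.delivers k a i = F'.delivers k a i) : F.lost k i = F'.lost k i := by
  simp only [lost, h]

theorem lost_mono (F : Adversary n t) (i : Fin n) : Monotone (F.lost · i) :=
  monotone_nat_of_le_succ fun k => Set.ncard_le_ncard fun j hj =>
    F.silent_of_crash k j (F.crash_of_lost k j i hj) (k + 1) k.lt_succ_self i

theorem le_lost_iff_subsingleton :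
    n - 1 ≤ F.lost k i ↔ {j | F.delivers k j i = true}.Subsingleton := by
  have hcompl : {j | F.delivers k j i = true} = {j | F.delivers k j i = false}ᶜ := by
    ext; simp
  have hadd := Set.ncard_add_ncard_compl {j | F.delivers k j i = false}
  rw [Nat.card_fin] at hadd
  rw [hcompl, ← Set.ncard_le_one_iff_subsingleton, lost]
  omega

/-! ### Indistinguishability -/

/-- Two scenarios, each a failure pattern with initial values, are similar at time `m` if some
surviving agent has the same initial value, has seen the same values and has missed the same numbers
of messages in both. This makes its local state the same, whatever record of the counts it keeps. -/
def Similar {α : Type*} (m : ℕ) (p q : Adversary n t × (Fin n → α)) : Prop :=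
  ∃ i, p.1.Alive m i ∧ q.1.Alive m i ∧ p.2 i = q.2 i ∧
    p.2 '' p.1.heardFrom m i = q.2 '' q.1.heardFrom m i ∧ ∀ k < m, p.1.lost k i = q.1.lost k i

/-- Two scenarios are linked if a chain of similarities leads from one to the other. -/
abbrev Linked {α : Type*} (m : ℕ) :
    Adversary n t × (Fin n → α) → Adversary n t × (Fin n → α) → Prop :=
  Relation.ReflTransGen (Similar m)

section linked

variable {α : Type*} {V V' : Fin n → α}

theorem Similar.symm {p q : Adversary n t × (Fin n → α)} (h : Similar m p q) : Similar m q p := by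
  obtain ⟨i, hp, hq, hinit, hseen, hlost⟩ := h
  exact ⟨i, hq, hp, hinit.symm, hseen.symm, fun k hk => (hlost k hk).symm⟩

theorem Linked.symm {p q : Adversary n t × (Fin n → α)} (h : Linked m p q) : Linked m q p := by
  induction h with
  | refl => exact .refl
  | tail _ h ih => exact .head h.symm ih

theorem linked_of_image_heardFrom_eq (hi : F.Alive m i) (hinit : V i = V' i)
    (hseen : V '' F.heardFrom m i = V' '' F.heardFrom m i) : Linked m (F, V) (F, V') :=
  .single ⟨i, hi, hi, hinit, hseen, fun _ _ => rfl⟩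

theorem linked_zero (hij : i ≠ j) (F : Adversary n t) (V V' : Fin n → α) :
    Linked 0 (F, V) (F, V') :=
  calc Linked 0 (F, V) (F, Function.update V' i (V i)) :=
        linked_of_image_heardFrom_eq (i := i) alive_zero (by simp) (by simp [heardFrom])
    Linked 0 _ (F, V') :=
        linked_of_image_heardFrom_eq (i := j) alive_zero (by simp [hij.symm])
          (by simp [heardFrom, hij.symm])

/-! ### Two survivors cannot detect failures -/

/-- If the values of two survivors `i` and `j` exhaust the initial values, then `i` has seen all of
them, so it notices a change of the failures only through the counts of missing messages. -/
theorem linked_of_delivers_eq (hm : 0 < m) (hV : Set.range V = {V i, V j}) (hi : F.Alive m i)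
    (hj : F.Alive m j) (hj' : F'.Alive m j)
    (h : ∀ k < m, ∀ a, F.delivers k a i = F'.delivers k a i) : Linked m (F, V) (F', V) := by
  refine .single ⟨i, hi, fun k hk => h k hk i ▸ hi k hk, rfl, ?_, fun k hk => lost_congr (h k hk)⟩
  exact (image_heardFrom_eq_range (hj.mem_heardFrom hm i) hV).trans
    (image_heardFrom_eq_range (hj'.mem_heardFrom hm i) hV).symm

/-- The failure pattern in which the agents in `s` do not fail, and which otherwise is `F`. -/
def heal (F : Adversary n t) (s : Finset (Fin n)) : Adversary n t where
  delivers k b j := decide (b ∈ s) || F.delivers k b j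
  crash_of_lost k b j := by
    simpa only [Bool.or_eq_false_iff] using And.imp_right (F.crash_of_lost k b j)
  silent_of_crash k b := by
    simp only [Bool.or_eq_false_iff]
    exact fun h k' hk j => ⟨h.1, F.silent_of_crash k b h.2 k' hk j⟩
  faulty_le := by
    refine (Set.ncard_le_ncard ?_).trans F.faulty_le
    rintro b ⟨k, j, h⟩
    exact ⟨k, j, (Bool.or_eq_false_iff.1 h).2⟩

theorem Alive.heal (h : F.Alive m i) (s : Finset (Fin n)) : (F.heal s).Alive m i := fun k hk => by
  simp [Adversary.heal, h k hk]

theorem alive_heal_of_mem {s : Finset (Fin n)} (hi : i ∈ s) (F : Adversary n t) (m : ℕ) :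
    (F.heal s).Alive m i := fun k _ => by simp [Adversary.heal, hi]

theorem heal_delivers_eq_of_alive {a b : Fin n} (ha : F.Alive m a) (hk : k < m) :
    (F.heal {a}).delivers k b j = F.delivers k b j := by
  by_cases hb : b = a
  · simp [heal, hb, ha.delivers hk]
  · simp [heal, hb]

theorem heal_insert (F : Adversary n t) (a : Fin n) (s : Finset (Fin n)) :
    F.heal (insert a s) = (F.heal s).heal {a} := by
  ext; simp [heal, Bool.or_assoc]

/-- The failure pattern in which agent `a`, which is faulty in `F`, crashes in round `c + 1` after
delivering its messages to the agents `j ≠ a` with `d j = true`, and which otherwise is `F`. -/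
def crashAt (F : Adversary n t) (a : Fin n) (ha : ∃ k, F.delivers k a a = false) (c : ℕ)
    (d : Fin n → Bool) : Adversary n t where
  delivers k b j :=
    if b = a then decide (k < c ∨ k = c ∧ j ≠ a ∧ d j = true) else F.delivers k b j
  crash_of_lost k b j := by
    split_ifs with hb
    · simp only [decide_eq_false_iff_not]
      grind
    · exact F.crash_of_lost k b j
  silent_of_crash k b := by
    split_ifs with hb
    · simp only [decide_eq_false_iff_not]
      grind
    · exact F.silent_of_crash k b
  faulty_le := by
    refine (Set.ncard_le_ncard ?_).trans F.faulty_le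
    rintro b ⟨k, j, h⟩
    split_ifs at h with hb
    · exact hb ▸ ha.imp fun k hk => ⟨a, hk⟩
    · exact ⟨k, j, h⟩

theorem Alive.crashAt {a : Fin n} (h : F.Alive m i) (hi : i ≠ a)
    (ha : ∃ k, F.delivers k a a = false) (c : ℕ) (d : Fin n → Bool) :
    (F.crashAt a ha c d).Alive m i := fun k hk => by
  simp [Adversary.crashAt, h k hk, hi]

theorem exists_crashAt_eq {a : Fin n} (ha : ∃ k, F.delivers k a a = false) :
    ∃ c d, F.crashAt a ha c d = F := by
  obtain ⟨c, hcrash, hbefore⟩ : ∃ c, F.delivers c a a = false ∧ F.Alive c a := by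
    classical
    exact ⟨Nat.find ha, Nat.find_spec ha, fun k hk => by simpa using Nat.find_min ha hk⟩
  refine ⟨c, F.delivers c a, ?_⟩
  ext k b j
  by_cases hb : b = a
  · subst hb
    rcases lt_trichotomy k c with hk | rfl | hk
    · simp [crashAt, hbefore.delivers hk, hk]
    · by_cases hj : j = b
      · simp [crashAt, hj, hcrash]
      · simp [crashAt, hj]
    · simp [crashAt, F.silent_of_crash c b hcrash k hk j, hk.not_gt, hk.ne']
  · simp [crashAt, hb]

/-- The crash of `a` can be postponed until after time `m`, one round at a time: `i` cannot tell to
which other agents the crashing agent delivers its last messages, and `j` cannot tell a crash in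
which it gets the last message of `a` from a crash of `a` in the next round without any delivery. -/
theorem linked_crashAt_heal {a : Fin n} (hm : 0 < m) (hij : i ≠ j) (hV : Set.range V = {V i, V j})
    (hi : F.Alive m i) (hj : F.Alive m j) (hia : i ≠ a) (hja : j ≠ a)
    (ha : ∃ k, F.delivers k a a = false) (c : ℕ) (d : Fin n → Bool) :
    Linked m (F.crashAt a ha c d, V) (F.heal {a}, V) := by
  by_cases hc : m ≤ c
  · refine linked_of_delivers_eq hm hV (hi.crashAt hia ha c d) (hj.crashAt hja ha c d) (hj.heal _)
      fun k hk b => ?_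
    simp [crashAt, heal, hk.trans_le hc]
  · have hi' := hi.crashAt hia ha
    have hj' := hj.crashAt hja ha
    calc Linked m (F.crashAt a ha c d, V)
          (F.crashAt a ha c (Function.update (fun _ => true) i (d i)), V) :=
          linked_of_delivers_eq hm hV (hi' _ _) (hj' _ _) (hj' _ _) (by simp [crashAt])
      Linked m _ (F.crashAt a ha (c + 1) fun _ => false, V) :=
          linked_of_delivers_eq hm (Set.pair_comm _ _ ▸ hV) (hj' _ _) (hi' _ _) (hi' _ _)
            (by simp [crashAt, hij.symm, hja, le_iff_lt_or_eq])
      Linked m _ (F.heal {a}, V) := linked_crashAt_heal hm hij hV hi hj hia hja ha (c + 1) _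
termination_by m - c

theorem linked_heal_singleton (hm : 0 < m) (hij : i ≠ j) (hV : Set.range V = {V i, V j})
    (hi : F.Alive m i) (hj : F.Alive m j) (a : Fin n) : Linked m (F, V) (F.heal {a}, V) := by
  by_cases ha : F.Alive m a
  · exact linked_of_delivers_eq hm hV hi hj (hj.heal _) fun k hk b =>
      (heal_delivers_eq_of_alive ha hk).symm
  · have hia : i ≠ a := fun h => ha (h ▸ hi)
    have hja : j ≠ a := fun h => ha (h ▸ hj)
    have hfaulty : ∃ k, F.delivers k a a = false := by
      by_contra! h
      exact ha fun k _ => by simpa using h k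
    obtain ⟨c, d, hF⟩ := exists_crashAt_eq hfaulty
    simpa only [hF] using linked_crashAt_heal hm hij hV hi hj hia hja hfaulty c d

theorem linked_heal (hm : 0 < m) (hij : i ≠ j) (hV : Set.range V = {V i, V j})
    (hi : F.Alive m i) (hj : F.Alive m j) (s : Finset (Fin n)) :
    Linked m (F, V) (F.heal s, V) := by
  induction s using Finset.induction_on with
  | empty => simpa [heal] using Relation.ReflTransGen.refl
  | insert a s _ ih =>
    rw [heal_insert]
    exact ih.trans (linked_heal_singleton hm hij hV (hi.heal s) (hj.heal s) a)

/-- The failure pattern without failures. -/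
def failureFree (n t : ℕ) : Adversary n t where
  delivers _ _ _ := true
  crash_of_lost _ _ _ := id
  silent_of_crash _ _ h := by cases h
  faulty_le := by simp

theorem alive_failureFree (n t m : ℕ) (i : Fin n) : (failureFree n t).Alive m i := fun _ _ => rfl

theorem heal_univ (F : Adversary n t) : F.heal Finset.univ = failureFree n t := by
  ext; simp [heal, failureFree]

theorem linked_failureFree (hm : 0 < m) (hij : i ≠ j) (hV : Set.range V = {V i, V j})
    (hi : F.Alive m i) (hj : F.Alive m j) : Linked m (F, V) (failureFree n t, V) :=
  F.heal_univ ▸ linked_heal hm hij hV hi hj Finset.univ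

theorem linked_failureFree_of_range_eq (hm : 0 < m) (hinit : V i = V' i)
    (hrange : Set.range V = Set.range V') :
    Linked m (failureFree n t, V) (failureFree n t, V') := by
  have hall : (failureFree n t).heardFrom m i = Set.univ :=
    Set.eq_univ_of_forall fun a => (alive_failureFree n t m a).mem_heardFrom hm i
  refine linked_of_image_heardFrom_eq (alive_failureFree n t m i) hinit ?_
  rw [hall, Set.image_univ, Set.image_univ, hrange]

/-! ### Hiding an initial value -/

/-- The failure pattern in which, for each `k < m`, agent number `k` crashes in round `k + 1`,
delivering a message to agent number `k + 1` only. At time `m`, the initial value of agent `0` has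
reached, among the survivors, only agent number `m`. -/
def chain (n : ℕ) (hm : m ≤ t) : Adversary n t where
  delivers k x y := decide (m ≤ x.val ∨ k < x.val ∨ k = x.val ∧ y.val = x.val + 1)
  crash_of_lost k x y := by
    simp only [decide_eq_false_iff_not]
    omega
  silent_of_crash k x := by
    simp only [decide_eq_false_iff_not]
    omega
  faulty_le := by
    refine (Set.ncard_le_ncard_of_injOn (t := Finset.range m) Fin.val ?_
      Fin.val_injective.injOn).trans ?_
    · rintro x ⟨k, y, hx⟩
      simp only [decide_eq_false_iff_not] at hx
      simp only [Finset.coe_range, Set.mem_Iio]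
      omega
    · rwa [Set.ncard_coe_finset, Finset.card_range]

theorem alive_chain (hm : m ≤ t) (hi : m ≤ i.val) : (chain n hm).Alive m i := fun k _ => by
  simp [chain, hi]

theorem mem_heardFrom_chain (hm : m ≤ t) (hk : k ≤ m) (hi : i.val = 0) (hj : j.val = k) :
    i ∈ (chain n hm).heardFrom k j := by
  induction k generalizing j with
  | zero => exact Fin.ext (hi.trans hj.symm)
  | succ k ih =>
    have hdelivers : (chain n hm).delivers k ⟨k, by omega⟩ j = true := by simp [chain, hj]
    exact Or.inr ⟨_, hdelivers, ih (by omega) rfl⟩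

theorem notMem_heardFrom_chain (hm : m ≤ t) (hk : k ≤ m) (hi : i.val = 0) (hj : k < j.val) :
    i ∉ (chain n hm).heardFrom k j := by
  induction k generalizing j with
  | zero =>
    rintro rfl
    omega
  | succ k ih =>
    rintro (h | ⟨a, ha, h⟩)
    · exact ih (by omega) (by omega) h
    · simp only [chain, decide_eq_true_eq] at ha
      exact ih (by omega) (by omega) h

theorem linked_const_update (hm : 0 < m) (hmt : m ≤ t) (hmn : m + 2 ≤ n) (x : Fin n) (v w : α) :
    Linked m (failureFree n t, fun _ => v) (failureFree n t, Function.update (fun _ => v) x w) := by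
  let first : Fin n := ⟨0, by omega⟩
  let i : Fin n := ⟨m, by omega⟩
  let j : Fin n := ⟨m + 1, by omega⟩
  have hfirst_i : first ≠ i := Fin.ne_of_val_ne hm.ne
  have hfirst_j : first ≠ j := Fin.ne_of_val_ne m.succ_ne_zero.symm
  have hij : i ≠ j := Fin.ne_of_val_ne m.succ_ne_self.symm
  have hi : (chain n hmt).Alive m i := alive_chain hmt le_rfl
  have hj : (chain n hmt).Alive m j := alive_chain hmt m.le_succ
  have hV_first := range_update_const hfirst_i v w
  have hV_j := range_update_const hij.symm v w
  obtain ⟨y, hyx, hyj⟩ := Fin.exists_ne_and_ne_of_two_lt x j (by omega)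
  calc Linked m (failureFree n t, fun _ => v) (chain n hmt, fun _ => v) := by
        refine (linked_failureFree hm hij ?_ hi hj).symm
        have : Nonempty (Fin n) := ⟨i⟩
        simp
    Linked m _ (chain n hmt, Function.update (fun _ => v) first w) := by
        refine linked_of_image_heardFrom_eq hj (by simp [hfirst_j.symm]) ?_
        refine Set.image_congr fun a ha => ?_
        have hne : a ≠ first := by
          rintro rfl
          exact notMem_heardFrom_chain hmt le_rfl rfl m.lt_succ_self ha
        simp [hne]
    Linked m _ (chain n hmt, Function.update (fun _ => v) j w) := by
        refine linked_of_image_heardFrom_eq hi (by simp [hfirst_i.symm, hij]) ?_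
        rw [image_heardFrom_eq_range (mem_heardFrom_chain hmt le_rfl (i := first) rfl rfl)
            (by simp [hV_first, hfirst_i.symm]),
          image_heardFrom_eq_range (hj.mem_heardFrom hm i) (by simp [hV_j, hij]), hV_first, hV_j]
    Linked m _ (failureFree n t, Function.update (fun _ => v) j w) :=
        linked_failureFree hm hij (by simp [hV_j, hij]) hi hj
    Linked m _ (failureFree n t, Function.update (fun _ => v) x w) :=
        linked_failureFree_of_range_eq (i := y) hm (by simp [hyx, hyj])
          (hV_j.trans (range_update_const hyx.symm v w).symm)

theorem linked_const_const (hm : 0 < m) (hmt : m ≤ t) (hmn : m + 2 ≤ n) (v w : α) :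
    Linked m (failureFree n t, fun _ => v) (failureFree n t, fun _ => w) := by
  let i : Fin n := ⟨0, by omega⟩
  let j : Fin n := ⟨1, by omega⟩
  have hij : i ≠ j := Fin.ne_of_val_ne zero_ne_one
  calc Linked m (failureFree n t, fun _ => v) (failureFree n t, Function.update (fun _ => v) i w) :=
        linked_const_update hm hmt hmn i v w
    Linked m _ (failureFree n t, Function.update (fun _ => w) j v) :=
        linked_failureFree_of_range_eq (i := i) hm (by simp [hij]) <| by
          rw [range_update_const hij, range_update_const hij.symm, Set.pair_comm]
    Linked m _ (failureFree n t, fun _ => w) := (linked_const_update hm hmt hmn j w v).symm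

theorem exists_linked_heal (hi : F.Alive (m + 1) i) (hlost : F.lost m i < n - 1)
    (V : Fin n → α) : ∃ j ≠ i, Linked (m + 1) (F, V) (F.heal {j}, V) := by
  have hnontrivial : {j | F.delivers m j i = true}.Nontrivial := by
    rwa [← Set.not_subsingleton_iff, ← le_lost_iff_subsingleton, not_le]
  obtain ⟨j, hj, hji⟩ := hnontrivial.exists_ne i
  have hearlier : ∀ k < m, ∀ a b, F.delivers k a b = (F.heal {j}).delivers k a b :=
    fun k hk a b => (heal_delivers_eq_of_alive (alive_of_delivers hj) hk).symm
  have hlast : ∀ a, F.delivers m a i = (F.heal {j}).delivers m a i := fun a => by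
    by_cases ha : a = j
    · simpa [heal, ha] using hj
    · simp [heal, ha]
  refine ⟨j, hji, .single ⟨i, hi, hi.heal _, rfl, ?_, fun k hk => lost_congr fun a => ?_⟩⟩
  · exact congrArg (V '' ·) (heardFrom_succ_congr hearlier hlast)
  · rcases Nat.lt_succ_iff_lt_or_eq.1 hk with hk | rfl
    exacts [hearlier k hk a i, hlast a]

end linked

theorem exists_linked_failureFree_update (hm : 0 < m) (hij : i ≠ j) (hi : F.Alive m i)
    (hj : F.Alive m j) (V : Fin n → Value) :
    ∃ w, Linked m (F, V) (failureFree n t, Function.update (fun _ => w) i (V i)) := by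
  obtain ⟨w, hw⟩ := exists_eq_pair_of_mem (Set.mem_image_of_mem V (F.self_mem_heardFrom m i))
  have hrange : Set.range (Function.update (fun _ => w) i (V i)) =
      {Function.update (fun _ => w) i (V i) i, Function.update (fun _ => w) i (V i) j} := by
    simp [range_update_const hij, hij.symm, Set.pair_comm]
  refine ⟨w, .trans ?_ (linked_failureFree hm hij hrange hi hj)⟩
  refine linked_of_image_heardFrom_eq hi (by simp) ?_
  rw [hw, image_heardFrom_eq_range (hj.mem_heardFrom hm i) hrange, range_update_const hij,
    Set.pair_comm]

theorem exists_linked_const (hm : m < min (t + 1) (n - 1)) (hi : F.Alive m i)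
    (hlost : ∀ k < m, F.lost k i < n - 1) (V : Fin n → Value) (v : Value) :
    ∃ G, Linked m (F, V) (G, fun _ => v) := by
  have hmt : m ≤ t := by omega
  have hmn : m + 2 ≤ n := by omega
  cases m with
  | zero =>
    have : Nontrivial (Fin n) := Fin.nontrivial_iff_two_le.2 hmn
    obtain ⟨j, hji⟩ := exists_ne i
    exact ⟨F, linked_zero hji F V _⟩
  | succ m =>
    obtain ⟨j, hji, hheal⟩ := exists_linked_heal hi (hlost m m.lt_succ_self) V
    have hj := alive_heal_of_mem (Finset.mem_singleton_self j) F (m + 1)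
    obtain ⟨w, hupdate⟩ :=
      exists_linked_failureFree_update m.succ_pos hji.symm (hi.heal _) hj V
    refine ⟨failureFree n t, ?_⟩
    calc Linked (m + 1) (F, V) (F.heal {j}, V) := hheal
      Linked (m + 1) _ (failureFree n t, Function.update (fun _ => w) i (V i)) := hupdate
      Linked (m + 1) _ (failureFree n t, fun _ => w) :=
          (linked_const_update m.succ_pos hmt hmn i w (V i)).symm
      Linked (m + 1) _ (failureFree n t, fun _ => v) := linked_const_const m.succ_pos hmt hmn w v

end Adversary

/-! ### Common knowledge as reachability -/

section commonKnowledge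

variable {E : InfoExchange n t} {R : Set (Run E)} {φ : Formula E} {r : Run E} {m : ℕ}
  {p q : Run E × ℕ}

/-- Some agent that has not failed at the point `p` considers the point `q` of the system `R`
possible at `p`. This is the accessibility relation of "everyone knows". -/
def ConsidersPossible (R : Set (Run E)) (p q : Run E × ℕ) : Prop :=
  q.1 ∈ R ∧ ∃ i ∈ nonfailed p.1 p.2, (p.1 p.2).2 i = (q.1 q.2).2 i

theorem everyoneKnows_iff :
    EveryoneKnows R φ p.1 p.2 ↔ ∀ q, ConsidersPossible R p q → φ q.1 q.2 :=
  ⟨fun h q ⟨hq, i, hi, he⟩ => h i hi q.1 hq q.2 he,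
    fun h i hi r hr m he => h (r, m) ⟨hr, i, hi, he⟩⟩

theorem CommonKnowledge.everyoneKnows (h : CommonKnowledge R φ r m) : EveryoneKnows R φ r m :=
  h 1 le_rfl

theorem CommonKnowledge.of_considersPossible (h : CommonKnowledge R φ p.1 p.2)
    (hpq : ConsidersPossible R p q) : CommonKnowledge R φ q.1 q.2 := by
  intro k hk
  have hsucc := h (k + 1) (hk.trans k.le_succ)
  rw [Function.iterate_succ_apply'] at hsucc
  exact everyoneKnows_iff.1 hsucc q hpq

theorem commonKnowledge_iff : CommonKnowledge R φ p.1 p.2 ↔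
    ∀ q, Relation.TransGen (ConsidersPossible R) p q → φ q.1 q.2 := by
  constructor
  · intro h q hpq
    induction hpq using Relation.TransGen.head_induction_on with
    | single hstep => exact everyoneKnows_iff.1 h.everyoneKnows q hstep
    | head hstep _ ih => exact ih (h.of_considersPossible hstep)
  · intro h k hk
    induction k, hk using Nat.le_induction generalizing p with
    | base => exact everyoneKnows_iff.2 fun q hpq => h q (.single hpq)
    | succ k _ ih =>
      rw [Function.iterate_succ_apply']
      exact everyoneKnows_iff.2 fun q hpq => ih fun q' hq' => h q' (.head hpq hq')

theorem commonKnowledge_of_invariant (S : Run E × ℕ → Prop) (hS : S (r, m))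
    (hφ : ∀ p, S p → φ p.1 p.2) (hinv : ∀ p q, S p → ConsidersPossible R p q → S q) :
    CommonKnowledge R φ r m :=
  commonKnowledge_iff (p := (r, m)).2 fun q hq => hφ q <| by
    induction hq with
    | single hstep => exact hinv _ _ hS hstep
    | tail _ hstep ih => exact hinv _ _ ih hstep

theorem commonKnowledge_of_nonfailed_eq_empty (h : nonfailed r m = ∅) :
    CommonKnowledge R φ r m := by
  refine commonKnowledge_iff (p := (r, m)).2 fun q hq => ?_
  obtain ⟨_, ⟨_, i, hi, _⟩, _⟩ := Relation.TransGen.head'_iff.1 hq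
  exact (h.subset hi).elim

end commonKnowledge

/-! ### Runs of the counting variants of FloodSet -/

section runs

variable {H : Type} {h₀ : H} {record : H → ℕ → H} {F G : Adversary n t} {V V' : Fin n → Value}
  {m m' : ℕ} {i j : Fin n}

/-- The variant of FloodSet with initial record `h₀` and record update `record`. The two protocols
at hand are the instances `countExchange` and `countRecallExchange`. -/
noncomputable def floodExchange {H : Type} (n t : ℕ) (h₀ : H) (record : H → ℕ → H) :
    InfoExchange n t where
  L := LocalState H
  M := Set Value
  crashed := .crashed
  start _ v := .active {v} h₀ 0 v
  send _ s _ _ := floodSend s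
  update i s F _ msgs := floodUpdate record i s F msgs

/-- The record that agent `i` has at time `m` if it has not crashed. -/
noncomputable def Adversary.history (h₀ : H) (record : H → ℕ → H) (F : Adversary n t)
    (i : Fin n) : ℕ → H
  | 0 => h₀
  | m + 1 => record (F.history h₀ record i m) (F.lost m i)

open Classical in
/-- The local state of agent `i` at time `m` under the adversary `F` and initial values `V`. -/
noncomputable def localState (h₀ : H) (record : H → ℕ → H) (F : Adversary n t)
    (V : Fin n → Value) (m : ℕ) (i : Fin n) : LocalState H :=
  if F.Alive m i then .active (V '' F.heardFrom m i) (F.history h₀ record i m) m (V i)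
  else .crashed

/-- The run with the adversary `F` and initial values `V`. -/
noncomputable def runOf (h₀ : H) (record : H → ℕ → H) (F : Adversary n t) (V : Fin n → Value) :
    Run (floodExchange n t h₀ record) :=
  fun m => (F, localState h₀ record F V m)

theorem Adversary.history_congr (h : ∀ k < m, F.lost k i = G.lost k i) :
    F.history h₀ record i m = G.history h₀ record i m := by
  induction m with
  | zero => rfl
  | succ m ih =>
    rw [history, history, ih fun k hk => h k (hk.trans m.lt_succ_self),
      h m m.lt_succ_self]

theorem Adversary.history_append_singleton (F : Adversary n t) (i : Fin n) (m : ℕ) :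
    F.history [0] (fun h c => h ++ [c]) i m = 0 :: (List.range m).map (F.lost · i) := by
  induction m with
  | zero => rfl
  | succ m ih => simp [Adversary.history, ih, List.range_succ]

theorem localState_eq_active_iff {W : Set Value} {h : H} {τ : ℕ} {v : Value} :
    localState h₀ record F V m i = .active W h τ v ↔
      F.Alive m i ∧ V '' F.heardFrom m i = W ∧ F.history h₀ record i m = h ∧ m = τ ∧ V i = v := by
  by_cases hi : F.Alive m i <;> simp [localState, hi]

theorem localState_of_alive (hi : F.Alive m i) : localState h₀ record F V m i =
    .active (V '' F.heardFrom m i) (F.history h₀ record i m) m (V i) :=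
  if_pos hi

theorem localState_of_not_alive (hi : ¬ F.Alive m i) :
    localState h₀ record F V m i = .crashed :=
  if_neg hi

theorem localState_zero : localState h₀ record F V 0 i = .active {V i} h₀ 0 (V i) :=
  localState_eq_active_iff.2 ⟨Adversary.alive_zero, Set.image_singleton, rfl, rfl, rfl⟩

theorem floodSend_localState (h : F.delivers m j i = true) :
    floodSend (localState h₀ record F V m j) = some (V '' F.heardFrom m j) := by
  rw [localState_of_alive (Adversary.alive_of_delivers h), floodSend]

theorem floodUpdate_localState (F : Adversary n t) (V : Fin n → Value) (m : ℕ) (i : Fin n) :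
    floodUpdate record i (localState h₀ record F V m i) F
        (fun j => if F.delivers m j i = true then floodSend (localState h₀ record F V m j)
          else none) =
      localState h₀ record F V (m + 1) i := by
  set msgs : Fin n → Option (Set Value) := fun j =>
    if F.delivers m j i = true then floodSend (localState h₀ record F V m j) else none
  have hmsgs : ∀ j, msgs j =
      if F.delivers m j i = true then some (V '' F.heardFrom m j) else none := fun j => by
    by_cases h : F.delivers m j i = true
    · simp only [msgs, if_pos h, floodSend_localState h]
    · simp only [msgs, if_neg h]
  have hmissing : missing msgs = F.lost m i := by simp [missing, Adversary.lost, hmsgs]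
  have hseen : V '' F.heardFrom m i ∪ {x | ∃ j W, msgs j = some W ∧ x ∈ W} =
      V '' F.heardFrom (m + 1) i := by
    simp only [hmsgs, Adversary.heardFrom, Set.image_union]
    congr 1
    ext x
    simp only [Option.ite_none_right_eq_some, Option.some.injEq, ↓existsAndEq, and_true,
      Set.mem_image, Set.mem_ofPred_eq]
    grind
  by_cases hi : F.Alive m i
  · by_cases hd : F.delivers m i i = true
    · have hi' := Adversary.alive_succ.2 ⟨hi, hd⟩
      rw [localState_of_alive hi, localState_of_alive hi', floodUpdate, if_pos hd, hseen, hmissing,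
        Adversary.history]
    · have hi' := fun h => hd (Adversary.alive_succ.1 h).2
      rw [localState_of_alive hi, localState_of_not_alive hi', floodUpdate, if_neg hd]
  · have hi' := fun h => hi (Adversary.alive_succ.1 h).1
    rw [localState_of_not_alive hi, localState_of_not_alive hi', floodUpdate]

variable {P : DecisionProtocol (floodExchange n t h₀ record)}

theorem runOf_mem_system (F : Adversary n t) (V : Fin n → Value) :
    runOf h₀ record F V ∈ system (floodExchange n t h₀ record) P :=
  ⟨⟨V, fun _ => localState_zero⟩,
    fun k => ⟨rfl, fun i => (floodUpdate_localState F V k i).symm⟩⟩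

theorem exists_eq_runOf {r : Run (floodExchange n t h₀ record)}
    (hr : r ∈ system (floodExchange n t h₀ record) P) : ∃ V, r = runOf h₀ record (r 0).1 V := by
  obtain ⟨⟨V, hV⟩, hstep⟩ := hr
  refine ⟨V, funext fun m => ?_⟩
  induction m with
  | zero => exact Prod.ext rfl (funext fun i => (hV i).trans localState_zero.symm)
  | succ m ih =>
    obtain ⟨hadversary, hlocal⟩ := hstep m
    refine Prod.ext (hadversary.trans (congrArg Prod.fst ih :)) (funext fun i => ?_)
    rw [hlocal i, ih]
    exact floodUpdate_localState _ V m i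

theorem mem_nonfailed_runOf : i ∈ nonfailed (runOf h₀ record F V) m ↔ F.Alive m i := by
  by_cases hi : F.Alive m i <;> simp [nonfailed, runOf, localState, hi, floodExchange]

theorem someInit_runOf {v : Value} : someInit v (runOf h₀ record F V) m ↔ v ∈ Set.range V := by
  refine exists_congr fun i => (localState_eq_active_iff (i := i)).trans ?_
  simp [Adversary.alive_zero, Adversary.heardFrom, Adversary.history]

theorem considersPossible_runOf_iff :
    ConsidersPossible (system (floodExchange n t h₀ record) P) (runOf h₀ record F V, m)
        (runOf h₀ record G V', m') ↔
      m = m' ∧ ∃ i, F.Alive m i ∧ G.Alive m i ∧ V i = V' i ∧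
        V '' F.heardFrom m i = V' '' G.heardFrom m i ∧
        F.history h₀ record i m = G.history h₀ record i m := by
  have hlocal : ∀ i, F.Alive m i → (localState h₀ record F V m i = localState h₀ record G V' m' i ↔
      G.Alive m' i ∧ V' '' G.heardFrom m' i = V '' F.heardFrom m i ∧
        G.history h₀ record i m' = F.history h₀ record i m ∧ m' = m ∧ V' i = V i) := fun i hi => by
    rw [localState_of_alive hi, eq_comm, localState_eq_active_iff]
  constructor
  · rintro ⟨-, i, hi, he⟩
    replace hi := mem_nonfailed_runOf.1 hi
    obtain ⟨hi', hseen, hrecord, rfl, hinit⟩ := (hlocal i hi).1 he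
    exact ⟨rfl, i, hi, hi', hinit.symm, hseen.symm, hrecord.symm⟩
  · rintro ⟨rfl, i, hi, hi', hinit, hseen, hrecord⟩
    exact ⟨runOf_mem_system G V', i, mem_nonfailed_runOf.2 hi,
      (hlocal i hi).2 ⟨hi', hseen.symm, hrecord.symm, rfl, hinit.symm⟩⟩

/-! ### Attaining common knowledge -/

theorem commonKnowledge_runOf_of_invariant {φ : Formula (floodExchange n t h₀ record)}
    (S : Adversary n t → (Fin n → Value) → Prop) (hS : S F V)
    (hφ : ∀ G V', S G V' → φ (runOf h₀ record G V') m)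
    (hinv : ∀ F V G V' i, S F V → F.Alive m i → G.Alive m i → V i = V' i →
      V '' F.heardFrom m i = V' '' G.heardFrom m i →
      F.history h₀ record i m = G.history h₀ record i m → S G V') :
    CommonKnowledge (system (floodExchange n t h₀ record) P) φ (runOf h₀ record F V) m := by
  refine commonKnowledge_of_invariant
    (fun p => ∃ G V', p = (runOf h₀ record G V', m) ∧ S G V') ⟨F, V, rfl, hS⟩ ?_ ?_
  · rintro _ ⟨G, V', rfl, h⟩
    exact hφ G V' h
  · rintro _ ⟨r, m'⟩ ⟨G, V', rfl, h⟩ hstep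
    obtain ⟨V'', hr⟩ : ∃ V'', r = runOf h₀ record (r 0).1 V'' := exists_eq_runOf hstep.1
    rw [hr] at hstep ⊢
    obtain ⟨rfl, i, hi, hi', hinit, hseen, hrecord⟩ := considersPossible_runOf_iff.1 hstep
    exact ⟨_, V'', rfl, hinv _ _ _ _ i h hi hi' hinit hseen hrecord⟩

theorem commonKnowledge_runOf_of_le (hm : min (t + 1) (n - 1) ≤ m) (hi : F.Alive m i) :
    CommonKnowledge (system (floodExchange n t h₀ record) P) (someInit (V i))
      (runOf h₀ record F V) m := by
  have spread : ∀ (G : Adversary n t) (V' : Fin n → Value) j, G.Alive m j →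
      V i ∈ V' '' G.heardFrom m j → ∀ a, G.Alive m a → V i ∈ V' '' G.heardFrom m a :=
    fun G V' j hj h a ha => Set.image_mono (G.agree_of_le hm j a hj ha) h
  refine commonKnowledge_runOf_of_invariant
    (fun G V' => (∃ j, G.Alive m j) ∧ ∀ j, G.Alive m j → V i ∈ V' '' G.heardFrom m j)
    ⟨⟨i, hi⟩, spread F V i hi (Set.mem_image_of_mem V (F.self_mem_heardFrom m i))⟩ ?_ ?_
  · rintro G V' ⟨⟨j, hj⟩, h⟩
    exact someInit_runOf.2 (Set.image_subset_range _ _ (h j hj))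
  · rintro F V' G V'' j ⟨-, h⟩ hj hj' - hseen -
    exact ⟨⟨j, hj'⟩, spread G V'' j hj' (hseen ▸ h j hj)⟩

/-- If `i` misses the messages of all other agents, then it is the only survivor from then on, and
its latest count tells so. -/
theorem commonKnowledge_runOf_of_le_lost
    (hrecord : ∀ h h' c c', record h c = record h' c' → c = c') (hi : F.Alive m i) {k : ℕ}
    (hk : k < m) (hlost : n - 1 ≤ F.lost k i) :
    CommonKnowledge (system (floodExchange n t h₀ record) P) (someInit (V i))
      (runOf h₀ record F V) m := by
  obtain ⟨m, rfl⟩ := Nat.exists_eq_add_one_of_ne_zero (Nat.ne_zero_of_lt hk)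
  refine commonKnowledge_runOf_of_invariant
    (fun G V' => G.Alive (m + 1) i ∧ n - 1 ≤ G.lost m i ∧ V' i = V i)
    ⟨hi, hlost.trans (F.lost_mono i (Nat.le_of_lt_succ hk)), rfl⟩
    (fun G V' h => someInit_runOf.2 ⟨i, h.2.2⟩) ?_
  rintro F V' G V'' j ⟨hi, hlost, hV'⟩ hj hj' hinit - hhistory
  have hji : j = i := Adversary.le_lost_iff_subsingleton.1 hlost
    (hj.delivers m.lt_succ_self i) (hi.delivers m.lt_succ_self i)
  subst hji
  exact ⟨hj', hrecord _ _ _ _ hhistory ▸ hlost, hinit ▸ hV'⟩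

/-! ### Common knowledge as a condition on the failures -/

theorem Adversary.Similar.considersPossible (h : Adversary.Similar m (F, V) (G, V')) :
    ConsidersPossible (system (floodExchange n t h₀ record) P) (runOf h₀ record F V, m)
      (runOf h₀ record G V', m) := by
  obtain ⟨i, hi, hi', hinit, hseen, hlost⟩ := h
  exact considersPossible_runOf_iff.2 ⟨rfl, i, hi, hi', hinit, hseen, history_congr hlost⟩

theorem Adversary.Linked.transGen_considersPossible (hi : F.Alive m i)
    (h : Adversary.Linked m (F, V) (G, V')) :
    Relation.TransGen (ConsidersPossible (system (floodExchange n t h₀ record) P))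
      (runOf h₀ record F V, m) (runOf h₀ record G V', m) := by
  have hself : ConsidersPossible (system (floodExchange n t h₀ record) P) (runOf h₀ record F V, m)
      (runOf h₀ record F V, m) :=
    ⟨runOf_mem_system F V, i, mem_nonfailed_runOf.2 hi, rfl⟩
  exact .head' hself <|
    h.lift (fun p => (runOf h₀ record p.1 p.2, m)) fun _ _ => Similar.considersPossible

theorem commonKnowledgeOfSomeValue_runOf_iff
    (hrecord : ∀ h h' c c', record h c = record h' c' → c = c') (hi : F.Alive m i) :
    CommonKnowledgeOfSomeValue (system (floodExchange n t h₀ record) P) (runOf h₀ record F V) m ↔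
      min (t + 1) (n - 1) ≤ m ∨ ∃ k < m, n - 1 ≤ F.lost k i := by
  constructor
  · rintro ⟨v, hv⟩
    by_contra! hcond
    obtain ⟨w, hw⟩ := exists_ne v
    obtain ⟨G, hG⟩ := Adversary.exists_linked_const hcond.1 hi hcond.2 V w
    obtain ⟨_, hwv⟩ := someInit_runOf.1 <|
      commonKnowledge_iff.1 hv _ (hG.transGen_considersPossible hi)
    exact hw hwv
  · rintro (hm | ⟨k, hk, hlost⟩)
    exacts [⟨V i, commonKnowledge_runOf_of_le hm hi⟩,
      ⟨V i, commonKnowledge_runOf_of_le_lost hrecord hi hk hlost⟩]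

theorem commonKnowledgeOfSomeValue_runOf_congr {H' : Type} {h₀' : H'} {record' : H' → ℕ → H'}
    {P' : DecisionProtocol (floodExchange n t h₀' record')}
    (hrecord : ∀ h h' c c', record h c = record h' c' → c = c')
    (hrecord' : ∀ h h' c c', record' h c = record' h' c' → c = c') :
    CommonKnowledgeOfSomeValue (system (floodExchange n t h₀ record) P) (runOf h₀ record F V) m ↔
      CommonKnowledgeOfSomeValue (system (floodExchange n t h₀' record') P')
        (runOf h₀' record' F V') m := by
  by_cases halive : ∃ i, F.Alive m i
  · obtain ⟨i, hi⟩ := halive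
    rw [commonKnowledgeOfSomeValue_runOf_iff hrecord hi,
      commonKnowledgeOfSomeValue_runOf_iff hrecord' hi]
  · exact iff_of_true
      ⟨0, commonKnowledge_of_nonfailed_eq_empty <| Set.eq_empty_of_forall_notMem fun i hi =>
        halive ⟨i, mem_nonfailed_runOf.1 hi⟩⟩
      ⟨0, commonKnowledge_of_nonfailed_eq_empty <| Set.eq_empty_of_forall_notMem fun i hi =>
        halive ⟨i, mem_nonfailed_runOf.1 hi⟩⟩

end runs

theorem Adversary.exists_le_getElem?_history_iff {F : Adversary n t} {i : Fin n} {m b : ℕ} :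
    (∃ k c, 1 ≤ k ∧ k ≤ m ∧ (F.history [0] (fun h c => h ++ [c]) i m)[k]? = some c ∧ b ≤ c) ↔
      ∃ k < m, b ≤ F.lost k i := by
  rw [F.history_append_singleton]
  constructor
  · rintro ⟨_ | k, c, hk, hkm, hc, hb⟩
    · omega
    · rw [List.getElem?_cons_succ, List.getElem?_map, List.getElem?_range hkm] at hc
      cases hc
      exact ⟨k, hkm, hb⟩
  · rintro ⟨k, hkm, hb⟩
    exact ⟨k + 1, F.lost k i, by omega, hkm, by simp [hkm], hb⟩

end FloodSBA

open FloodSBA in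
theorem mainTheorem6_general (n t : ℕ) (P : DecisionProtocol (countRecallExchange n t))
    (r : Run (countRecallExchange n t)) (hr : r ∈ system (countRecallExchange n t) P) (m : ℕ) :
    (∀ (i : Fin n) (W : Set Value) (h : List ℕ) (τ : ℕ) (v : Value),
      (r m).2 i = LocalState.active W h τ v →
        (CommonKnowledgeOfSomeValue (system (countRecallExchange n t) P) r m ↔
          (min (t + 1) (n - 1) ≤ m ∨ ∃ k c : ℕ, 1 ≤ k ∧ k ≤ m ∧ h[k]? = some c ∧ n - 1 ≤ c))) ∧
    (∀ (P' : DecisionProtocol (countExchange n t)) (r' : Run (countExchange n t)),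
      r' ∈ system (countExchange n t) P' → (r 0).1 = (r' 0).1 →
        (CommonKnowledgeOfSomeValue (system (countRecallExchange n t) P) r m ↔
          CommonKnowledgeOfSomeValue (system (countExchange n t) P') r' m)) := by
  have hrecord (h h' : List ℕ) (c c' : ℕ) (he : h ++ [c] = h' ++ [c']) : c = c' :=
    (List.append_singleton_inj.1 he).2
  obtain ⟨V, hV⟩ := exists_eq_runOf (h₀ := [0]) (record := fun h c => h ++ [c]) (P := P) hr
  generalize (r 0).1 = F at hV ⊢
  subst hV
  constructor
  · intro i W h τ v hstate
    obtain ⟨hi, -, rfl, -, -⟩ := localState_eq_active_iff.1 hstate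
    rw [Adversary.exists_le_getElem?_history_iff]
    exact commonKnowledgeOfSomeValue_runOf_iff hrecord hi
  · intro P' r' hr' hF
    obtain ⟨V', hV'⟩ := exists_eq_runOf (h₀ := 0) (record := fun _ c => c) (P := P') hr'
    rw [hV', ← hF]
    exact commonKnowledgeOfSomeValue_runOf_congr hrecord fun _ _ _ _ => id

theorem mainTheorem6 (n t : ℕ) (ht : t < n)
    (P : FloodSBA.DecisionProtocol (FloodSBA.countRecallExchange n t))
    (r : FloodSBA.Run (FloodSBA.countRecallExchange n t))
    (hr : r ∈ FloodSBA.system (FloodSBA.countRecallExchange n t) P) (m : ℕ) :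
    (∀ (i : Fin n) (W : Set FloodSBA.Value) (h : List ℕ) (τ : ℕ) (v : FloodSBA.Value),
      (r m).2 i = FloodSBA.LocalState.active W h τ v →
        (FloodSBA.CommonKnowledgeOfSomeValue
            (FloodSBA.system (FloodSBA.countRecallExchange n t) P) r m ↔
          (min (t + 1) (n - 1) ≤ m ∨
            ∃ k c : ℕ, 1 ≤ k ∧ k ≤ m ∧ h[k]? = some c ∧ n - 1 ≤ c))) ∧
    (∀ (P' : FloodSBA.DecisionProtocol (FloodSBA.countExchange n t))
      (r' : FloodSBA.Run (FloodSBA.countExchange n t)),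
      r' ∈ FloodSBA.system (FloodSBA.countExchange n t) P' →
        FloodSBA.Corresponding r r' →
          (FloodSBA.CommonKnowledgeOfSomeValue
              (FloodSBA.system (FloodSBA.countRecallExchange n t) P) r m ↔
            FloodSBA.CommonKnowledgeOfSomeValue
              (FloodSBA.system (FloodSBA.countExchange n t) P') r' m)) :=
  ⟨(mainTheorem6_general n t P r hr m).1, fun P' r' hr' hcorr =>
    (mainTheorem6_general n t P r hr m).2 P' r' hr' hcorr.1⟩
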